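/- Let $\mathbb{F}_q$ be a finite field and let $A(Y),B(X)$ be univariate polynomials over $\mathbb{F}_q$ of coprime degrees $a=\deg A$ and $b=\deg B\ge 2$, such that $A(Y)-B(X)$ is absolutely irreducible. Let $\mathcal{X}$ be the (non-singular projective) curve over $\mathbb{F}_q$ with affine equation $A(Y)=B(X)$, and let $x,y\in\mathbb{F}_q(\mathcal{X})$ be the coordinate functions. Let $\mathcal{U}$ be a set of elements $\beta\in\mathbb{F}_q$ (for instance the set of all of them) whose fibre $y^{-1}(\beta)$ is totally split, that is, consists of $b$ distinct rational points of $\mathcal{X}$. Put $\mathcal{P}=\bigcup_{\beta\in\mathcal{U}}y^{-1}(\beta)$ and $n=\#\mathcal{P}$. For $i=0,\dots,b-2$ let $\epsilon_i\in\{0,1\}$ and let $\ell_i\ge 0$ be an integer, and set $$V=\sum_{i=0}^{b-2}\epsilon_i\langle 1,y,\dots,y^{\ell_i}\rangle x^i,\qquad m=\max\{\epsilon_i(\ell_i b+ia)\;:\;0\le i\le b-2\},$$ where $\langle\cdots\rangle$ denotes the $\mathbb{F}_q$-linear span. Let $\mathrm{ev}_{\mathcal{P}}(f)=(f(P))_{P\in\mathcal{P}}$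 and let $\mathcal{C}(\mathcal{P},V)=\mathrm{ev}_{\mathcal{P}}(V)\subseteq\mathbb{F}_q^n$. Assume $\epsilon_0=1$. If $\ell_0 b\ge n$, then the code $\mathcal{C}(\mathcal{P},V)$ is abundant, i.e. $\mathrm{ev}_{\mathcal{P}}$ is not injective on $V$. If $\ell_0 b<n$, then $\mathcal{C}(\mathcal{P},V)$ has at least two codewords and its minimum distance $d$ satisfies $n-m\le d\le n-\ell_0 b$. -/

import Mathlib

open Polynomial

noncomputable section

namespace SeparatedCurve

/-- The polynomial `A(Y) - B(X)` over `K`, viewed in `K[Y][X]`: the inner variable is `Y`,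
the outer variable is `X`. -/
def equation {K : Type*} [Field K] (A B : K[X]) : K[X][X] :=
  C A - B.map C

/-- `A(Y) - B(X)` stays irreducible over an algebraic closure of `K`. -/
def AbsolutelyIrreducible {K : Type*} [Field K] (A B : K[X]) : Prop :=
  Irreducible ((equation A B).map (mapRingHom (algebraMap K (AlgebraicClosure K))))

/-- The affine coordinate ring `K[X,Y] / (A(Y) - B(X))`. -/
abbrev CoordinateRing {K : Type*} [Field K] (A B : K[X]) : Type _ :=
  AdjoinRoot (equation A B)

/-- The function field `K(𝒳)` of the curve `𝒳 : A(Y) = B(X)`. -/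
abbrev FunctionField {K : Type*} [Field K] (A B : K[X]) : Type _ :=
  FractionRing (CoordinateRing A B)

theorem isLocalHom_mapRingHom {R S : Type*} [CommRing R] [IsDomain R] [CommRing S] [IsDomain S]
    (f : R →+* S) (hf : Function.Injective f) (hl : IsLocalHom f) : IsLocalHom (mapRingHom f) := by
  refine ⟨fun p hp => ?_⟩
  obtain ⟨u, hu, hup⟩ := Polynomial.isUnit_iff.1 hp
  have hd : p.natDegree = 0 := by
    rw [← natDegree_map_eq_of_injective hf p, ← coe_mapRingHom, ← hup, natDegree_C]
  rw [eq_C_of_natDegree_eq_zero hd] at hup ⊢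
  rw [coe_mapRingHom, map_C] at hup
  rw [C_injective hup] at hu
  exact isUnit_C.2 (hl.map_nonunit _ hu)

theorem irreducible_equation {K : Type*} [Field K] {A B : K[X]}
    (h : AbsolutelyIrreducible A B) : Irreducible (equation A B) := by
  have h' : Irreducible
      (mapRingHom (mapRingHom (algebraMap K (AlgebraicClosure K))) (equation A B)) := h
  have hi := (algebraMap K (AlgebraicClosure K)).injective
  have h1 := isLocalHom_mapRingHom _ hi inferInstance
  have h2 := isLocalHom_mapRingHom _ (map_injective _ hi) h1
  exact h'.of_map

instance isDomain_coordinateRing {K : Type*} [Field K] (A B : K[X])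
    [h : Fact (AbsolutelyIrreducible A B)] : IsDomain (CoordinateRing A B) :=
  AdjoinRoot.isDomain_of_prime (irreducible_equation h.out).prime

/-- The coordinate function `x`. -/
def xFun {K : Type*} [Field K] (A B : K[X]) : FunctionField A B :=
  algebraMap (CoordinateRing A B) (FunctionField A B) (AdjoinRoot.root (equation A B))

/-- The coordinate function `y`. -/
def yFun {K : Type*} [Field K] (A B : K[X]) : FunctionField A B :=
  algebraMap (CoordinateRing A B) (FunctionField A B) (AdjoinRoot.of (equation A B) X)

/-- A rational place of a field extension `F` of `K`, i.e. (when `F` is a function field in one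
variable over `K`) a `K`-rational point of the non-singular projective curve with function field
`F`: a proper valuation ring of `F` containing `K`, whose residue field is `K`. Here `nonunits` is
the maximal ideal of the valuation ring. -/
structure RationalPlace (K F : Type*) [Field K] [Field F] [Algebra K F] where
  /-- The local ring of functions that are regular at the point. -/
  ring : ValuationSubring F
  ne_top : ring ≠ ⊤
  algebraMap_mem : ∀ c : K, algebraMap K F c ∈ ring
  exists_residue : ∀ f ∈ ring, ∃ c : K, f - algebraMap K F c ∈ ring.nonunits

open Classical in
/-- The value `f(P) ∈ K` of a function `f` that is regular at `P`
(and `0`, by convention, when `f` has a pole at `P`). -/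
def RationalPlace.eval {K F : Type*} [Field K] [Field F] [Algebra K F]
    (P : RationalPlace K F) (f : F) : K :=
  if h : f ∈ P.ring then (P.exists_residue f h).choose else 0

/-- The value of a regular function at `P` is its residue class. -/
theorem RationalPlace.eval_eq_iff {K F : Type*} [Field K] [Field F] [Algebra K F]
    (P : RationalPlace K F) {f : F} (hf : f ∈ P.ring) (c : K) :
    P.eval f = c ↔ f - algebraMap K F c ∈ P.ring.nonunits := by
  have h0 : f - algebraMap K F (P.eval f) ∈ P.ring.nonunits := by
    rw [RationalPlace.eval, dif_pos hf]
    exact (P.exists_residue f hf).choose_spec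
  constructor
  · rintro rfl
    exact h0
  · intro hc
    by_contra hne
    rw [ValuationSubring.mem_nonunits_iff] at h0 hc
    have h1 : P.ring.valuation (algebraMap K F (P.eval f - c)) < 1 := by
      have h2 := P.ring.valuation.map_sub (f - algebraMap K F c) (f - algebraMap K F (P.eval f))
      have h3 : f - algebraMap K F c - (f - algebraMap K F (P.eval f))
          = algebraMap K F (P.eval f - c) := by rw [map_sub]; ring
      rw [h3] at h2
      exact lt_of_le_of_lt h2 (max_lt hc h0)
    have h4 : P.ring.valuation (algebraMap K F (P.eval f - c)⁻¹) ≤ 1 :=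
      (P.ring.valuation_le_one_iff _).2 (P.algebraMap_mem _)
    have h5 : P.ring.valuation (algebraMap K F (P.eval f - c)) *
        P.ring.valuation (algebraMap K F (P.eval f - c)⁻¹) = 1 := by
      rw [← map_mul, ← map_mul, mul_inv_cancel₀ (sub_ne_zero.2 hne), map_one, map_one]
    have h6 := mul_lt_one_of_lt_of_le h1 h4
    exact absurd h5 h6.ne

/-- The fibre `φ⁻¹(β)`: the rational points at which `φ` is regular with value `β`. -/
def fibre {K F : Type*} [Field K] [Field F] [Algebra K F] (φ : F) (β : K) :
    Set (RationalPlace K F) :=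
  {P | φ ∈ P.ring ∧ P.eval φ = β}

/-- The union of the fibres of `φ` over the elements of `U`. -/
def evalPoints {K F : Type*} [Field K] [Field F] [Algebra K F] (φ : F) (U : Set K) :
    Set (RationalPlace K F) :=
  ⋃ β ∈ U, fibre φ β

/-- The evaluation map `f ↦ (f(P))_{P ∈ Pts}`. -/
def ev {K F : Type*} [Field K] [Field F] [Algebra K F] (Pts : Set (RationalPlace K F)) (f : F) :
    Pts → K :=
  fun P => P.1.eval f

/-- The space `V = ∑_{i < r} ε_i ⟨1, φ₁, …, φ₁ ^ ℓ_i⟩ φ₂ ^ i`. -/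
def funSpace (K : Type*) {F : Type*} [Field K] [Field F] [Algebra K F] (φ₁ φ₂ : F) (r : ℕ)
    (ε ℓ : ℕ → ℕ) : Submodule K F :=
  Submodule.span K {f | ∃ i < r, ∃ j ≤ ℓ i, f = (ε i : F) * (φ₁ ^ j * φ₂ ^ i)}

/-- The code `𝒞(Pts, V) = ev(V)`. -/
def code {K F : Type*} [Field K] [Field F] [Algebra K F] (Pts : Set (RationalPlace K F))
    (V : Submodule K F) : Set (Pts → K) :=
  ev Pts '' V

/-- The code `𝒞(Pts, V)` is abundant: evaluation is not injective on `V`. -/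
def IsAbundant {K F : Type*} [Field K] [Field F] [Algebra K F] (Pts : Set (RationalPlace K F))
    (V : Submodule K F) : Prop :=
  ¬ Set.InjOn (ev Pts) V

/-- `d` is the minimum distance of the code `𝒞` (over a finite index set `ι`): the least Hamming
distance between two different codewords. In particular `𝒞` has two different codewords. -/
def IsMinDist {ι K : Type*} (𝒞 : Set (ι → K)) (d : ℕ) : Prop :=
  IsLeast {w | ∃ c ∈ 𝒞, ∃ c' ∈ 𝒞, c ≠ c' ∧ w = {i | c i ≠ c' i}.ncard} d

/-- `m(V) = max {ε_i (ℓ_i v₁ + i v₂) : i < r}`, where `v₁, v₂` are the pole orders of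
`φ₁, φ₂`. -/
def poleBound (v₁ v₂ r : ℕ) (ε ℓ : ℕ → ℕ) : ℕ :=
  (Finset.range r).sup fun i => ε i * (ℓ i * v₁ + i * v₂)

/-- The set of all `β ∈ K` whose fibre under `y` is totally split: it consists of
`b = deg B = v(y)` distinct rational points. -/
def splitValues {K : Type*} [Field K] (A B : K[X]) [Fact (AbsolutelyIrreducible A B)] : Set K :=
  {β | (fibre (yFun A B) β).ncard = B.natDegree}

end SeparatedCurve

end

/-! ### Evaluation at rational places and functions separating them. -/

namespace SeparatedCurve

namespace RationalPlace

variable {K F : Type*} [Field K] [Field F] [Algebra K F]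

/-! The upper bound on `d` and abundance come from polynomials in `y`: the product of `y - β` over a
set `S ⊆ U` with at most `ℓ 0` elements lies in `V` and vanishes at exactly `#S * b` evaluation
points, since split fibres are disjoint and have `b` points each. Taking all of `U` gives a nonzero
function in the kernel of evaluation; taking `#S = ℓ 0` gives a word of weight `n - ℓ 0 * b`.

The lower bound says that a nonzero `f` of weight at most `m` has at most `m` rational zeros
(`card_zeros_le_of_mem_weightSpace`), where `y ^ j * x ^ i` has weight `j * b + i * a`. Divisor
degrees are replaced by a dimension count. Functions of weight at most `N` form a space of dimension
at most `N + 1` (`weightSpace_finrank_le`). If `f` vanishes on a finite set `s`, take functions `e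
P` dual to `s` (`exists_eval_eq_ite`) and a common denominator `H`. The products `H * f ^ k * e P`
with `k < J` are `J * #s` independent functions (`linearIndependent_pow_mul`) of weight at most `m *
(J - 1) + D`, with `D` independent of `J`. Large `J` forces `#s ≤ m`. -/

theorem sub_eval_mem_nonunits (P : RationalPlace K F) {f : F} (hf : f ∈ P.ring) :
    f - algebraMap K F (P.eval f) ∈ P.ring.nonunits :=
  (P.eval_eq_iff hf _).1 rfl

theorem eval_eq_zero_iff (P : RationalPlace K F) {f : F} (hf : f ∈ P.ring) :
    P.eval f = 0 ↔ f ∈ P.ring.nonunits := by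
  rw [P.eval_eq_iff hf, map_zero, sub_zero]

theorem add_mem_nonunits (P : RationalPlace K F) {f g : F} (hf : f ∈ P.ring.nonunits)
    (hg : g ∈ P.ring.nonunits) : f + g ∈ P.ring.nonunits := by
  rw [ValuationSubring.mem_nonunits_iff] at *
  exact P.ring.valuation.map_add_lt hf hg

theorem mul_mem_nonunits (P : RationalPlace K F) {f g : F} (hf : f ∈ P.ring)
    (hg : g ∈ P.ring.nonunits) : f * g ∈ P.ring.nonunits := by
  rw [ValuationSubring.mem_nonunits_iff] at *
  rw [mul_comm, map_mul]
  exact mul_lt_one_of_lt_of_le hg ((P.ring.valuation_le_one_iff _).2 hf)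

theorem eval_algebraMap (P : RationalPlace K F) (c : K) : P.eval (algebraMap K F c) = c := by
  rw [P.eval_eq_iff (P.algebraMap_mem c), sub_self, ValuationSubring.mem_nonunits_iff, map_zero]
  exact zero_lt_one

theorem eval_zero (P : RationalPlace K F) : P.eval 0 = 0 := by
  simpa using P.eval_algebraMap 0

theorem eval_one (P : RationalPlace K F) : P.eval 1 = 1 := by
  simpa using P.eval_algebraMap 1

theorem eval_add (P : RationalPlace K F) {f g : F} (hf : f ∈ P.ring) (hg : g ∈ P.ring) :
    P.eval (f + g) = P.eval f + P.eval g := by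
  rw [P.eval_eq_iff (add_mem hf hg), map_add, add_sub_add_comm]
  exact P.add_mem_nonunits (P.sub_eval_mem_nonunits hf) (P.sub_eval_mem_nonunits hg)

theorem eval_mul (P : RationalPlace K F) {f g : F} (hf : f ∈ P.ring) (hg : g ∈ P.ring) :
    P.eval (f * g) = P.eval f * P.eval g := by
  rw [P.eval_eq_iff (mul_mem hf hg), map_mul]
  have h : f * g - algebraMap K F (P.eval f) * algebraMap K F (P.eval g) =
      f * (g - algebraMap K F (P.eval g)) +
        algebraMap K F (P.eval g) * (f - algebraMap K F (P.eval f)) := by ring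
  rw [h]
  exact P.add_mem_nonunits (P.mul_mem_nonunits hf (P.sub_eval_mem_nonunits hg))
    (P.mul_mem_nonunits (P.algebraMap_mem _) (P.sub_eval_mem_nonunits hf))

/-- Evaluation at a rational place as a ring homomorphism from its valuation ring. -/
noncomputable def evalHom (P : RationalPlace K F) : P.ring →+* K where
  toFun f := P.eval f
  map_one' := P.eval_one
  map_mul' f g := P.eval_mul f.2 g.2
  map_zero' := P.eval_zero
  map_add' f g := P.eval_add f.2 g.2

theorem eval_sub (P : RationalPlace K F) {f g : F} (hf : f ∈ P.ring) (hg : g ∈ P.ring) :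
    P.eval (f - g) = P.eval f - P.eval g :=
  map_sub P.evalHom ⟨f, hf⟩ ⟨g, hg⟩

theorem eval_pow (P : RationalPlace K F) {f : F} (hf : f ∈ P.ring) (n : ℕ) :
    P.eval (f ^ n) = P.eval f ^ n :=
  map_pow P.evalHom ⟨f, hf⟩ n

theorem eval_prod (P : RationalPlace K F) {ι : Type*} (s : Finset ι) (f : ι → F)
    (hf : ∀ i ∈ s, f i ∈ P.ring) :
    (∏ i ∈ s, f i) ∈ P.ring ∧ P.eval (∏ i ∈ s, f i) = ∏ i ∈ s, P.eval (f i) := by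
  classical
  induction s using Finset.induction_on with
  | empty => exact ⟨P.ring.one_mem, P.eval_one⟩
  | insert i s hi ih =>
    obtain ⟨h1, h2⟩ := ih fun j hj => hf j (Finset.mem_insert_of_mem hj)
    have h3 := hf i (Finset.mem_insert_self i s)
    rw [Finset.prod_insert hi, Finset.prod_insert hi, P.eval_mul h3 h1, h2]
    exact ⟨mul_mem h3 h1, rfl⟩

theorem eval_sum (P : RationalPlace K F) {ι : Type*} (s : Finset ι) (f : ι → F)
    (hf : ∀ i ∈ s, f i ∈ P.ring) :
    P.eval (∑ i ∈ s, f i) = ∑ i ∈ s, P.eval (f i) := by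
  classical
  induction s using Finset.induction_on with
  | empty => simpa using P.eval_zero
  | insert i s hi ih =>
    have h := fun j hj => hf j (Finset.mem_insert_of_mem hj)
    rw [Finset.sum_insert hi, Finset.sum_insert hi,
      P.eval_add (hf i (Finset.mem_insert_self i s)) (sum_mem h), ih h]

/-- Enlarging a valuation ring shrinks its maximal ideal. Any `f` regular at `Q` is a constant plus
an element of the ideal of `Q`, hence regular at `P`. So distinct places are separated by a function
regular at one only. -/
theorem eq_of_ring_le {P Q : RationalPlace K F} (h : P.ring ≤ Q.ring) : P = Q := by
  have h1 : P.ring = Q.ring := by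
    refine le_antisymm h fun f hf => ?_
    have h2 := ValuationSubring.nonunits_le_nonunits.2 h (Q.sub_eval_mem_nonunits hf)
    have h3 := add_mem (ValuationSubring.nonunits_subset h2) (P.algebraMap_mem (Q.eval f))
    simpa using h3
  cases P
  cases Q
  simpa using h1

/-- Over a finite field, `1 / (f ^ q - f + 1)` takes the value `1` at the rational places where
`f` is regular and the value `0` at the others. -/
theorem eval_inv_pow_card_sub_add_one [Finite K] (P : RationalPlace K F) (f : F) :
    (f ^ Nat.card K - f + 1)⁻¹ ∈ P.ring ∧
      (f ∈ P.ring → P.eval (f ^ Nat.card K - f + 1)⁻¹ = 1) ∧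
      (f ∉ P.ring → P.eval (f ^ Nat.card K - f + 1)⁻¹ = 0) := by
  have := Fintype.ofFinite K
  by_cases hf : f ∈ P.ring
  · have h1 : f ^ Nat.card K - f + 1 ∈ P.ring := add_mem (sub_mem (pow_mem hf _) hf) (one_mem _)
    have h2 : P.eval (f ^ Nat.card K - f + 1) = 1 := by
      rw [P.eval_add (sub_mem (pow_mem hf _) hf) (one_mem _), P.eval_sub (pow_mem hf _) hf,
        P.eval_pow hf, P.eval_one, Nat.card_eq_fintype_card, FiniteField.pow_card]
      simp
    have h3 : f ^ Nat.card K - f + 1 ≠ 0 := by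
      intro h
      rw [h, P.eval_zero] at h2
      exact zero_ne_one h2
    have h4 : (f ^ Nat.card K - f + 1)⁻¹ ∈ P.ring := by
      by_contra h
      have h5 := (P.eval_eq_zero_iff h1).2 (P.ring.mem_nonunits_iff_or.2 (Or.inr h))
      exact one_ne_zero (h2.symm.trans h5)
    refine ⟨h4, fun _ => ?_, fun h => absurd hf h⟩
    have h5 := P.eval_mul h1 h4
    rw [mul_inv_cancel₀ h3, h2, P.eval_one, one_mul] at h5
    exact h5.symm
  -- At a pole the term `f ^ q` dominates, so the inverse lies in the maximal ideal.
  · have h1 : 1 < P.ring.valuation f := by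
      rw [← not_le, P.ring.valuation_le_one_iff]
      exact hf
    have h2 : P.ring.valuation f < P.ring.valuation (f ^ Nat.card K) := by
      rw [map_pow]
      exact lt_self_pow₀ h1 Finite.one_lt_card
    have h3 : P.ring.valuation (f ^ Nat.card K - f + 1) = P.ring.valuation (f ^ Nat.card K) := by
      have h4 := Valuation.map_sub_eq_of_lt_left _ h2
      rw [Valuation.map_add_eq_of_lt_left, h4]
      rw [h4, map_one]
      exact h1.trans h2
    have h4 : (f ^ Nat.card K - f + 1)⁻¹ ∈ P.ring.nonunits := by
      rw [ValuationSubring.mem_nonunits_iff, map_inv₀, h3]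
      exact inv_lt_one_of_one_lt₀ (h1.trans h2)
    have h5 := ValuationSubring.nonunits_subset h4
    exact ⟨h5, fun h => absurd h hf, fun _ => (P.eval_eq_zero_iff h5).2 h4⟩

/-- Weak approximation for finitely many rational places over a finite field. -/
theorem exists_eval_eq_ite [Finite K] (s : Finset (RationalPlace K F)) (P : RationalPlace K F) :
    ∃ e : F, (∀ Q : RationalPlace K F, e ∈ Q.ring) ∧ P.eval e = 1 ∧
      ∀ Q ∈ s, Q ≠ P → Q.eval e = 0 := by
  classical
  have h (Q : RationalPlace K F) (hQ : Q ≠ P) : ∃ f : F, f ∈ P.ring ∧ f ∉ Q.ring := by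
    by_contra! h
    exact hQ (eq_of_ring_le (P := P) h).symm
  choose! f hfP hfQ using h
  have hm (Q R : RationalPlace K F) := R.eval_inv_pow_card_sub_add_one (f Q)
  have hp (R : RationalPlace K F) := R.eval_prod (s.erase P)
    (fun Q => (f Q ^ Nat.card K - f Q + 1)⁻¹) fun Q _ => (hm Q R).1
  -- `f Q` is regular at `P` with a pole at `Q`, so the factor of index `Q` is `1` at `P` and `0` at
  -- `Q`; every factor is regular at all rational places.
  refine ⟨∏ Q ∈ s.erase P, (f Q ^ Nat.card K - f Q + 1)⁻¹, fun R => (hp R).1, ?_, ?_⟩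
  · rw [(hp P).2]
    exact Finset.prod_eq_one fun Q hQ => (hm Q P).2.1 (hfP Q (Finset.ne_of_mem_erase hQ))
  · intro Q hQ hQP
    rw [(hp Q).2]
    exact Finset.prod_eq_zero (Finset.mem_erase.2 ⟨hQP, hQ⟩) ((hm Q Q).2.2 (hfQ Q hQP))

/-- If `f` vanishes at the places in `s`, functions that are dual to `s` are linearly independent
over `K[f]`. -/
theorem linearIndependent_pow_mul {s : Finset (RationalPlace K F)} {f : F} (hf0 : f ≠ 0)
    (hf : ∀ P ∈ s, f ∈ P.ring.nonunits) (e : s → F) (he : ∀ P Q : s, e P ∈ Q.1.ring)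
    (he1 : ∀ P : s, P.1.eval (e P) = 1) (he0 : ∀ P Q : s, Q ≠ P → Q.1.eval (e P) = 0) (J : ℕ) :
    LinearIndependent K (fun t : Fin J × s => f ^ (t.1 : ℕ) * e t.2) := by
  rw [Fintype.linearIndependent_iff]
  intro g hg
  suffices h : ∀ j : ℕ, ∀ hj : j < J, ∀ Q : s, g (⟨j, hj⟩, Q) = 0 from fun t => h t.1 t.1.2 t.2
  intro j
  induction j using Nat.strong_induction_on with
  | _ j ih =>
  intro hj Q
  have hfQ := hf Q Q.2
  have hfQ' := ValuationSubring.nonunits_subset hfQ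
  -- The coefficients of lower index vanish by induction, so the relation can be divided by `f ^ j`.
  -- Evaluated at `Q`, only the term `(j, Q)` survives: higher powers of `f` vanish there, and so do
  -- the other `e R`.
  have hsum : ∑ t : Fin J × s,
      algebraMap K F (g t) * (if (t.1 : ℕ) < j then 0 else f ^ ((t.1 : ℕ) - j) * e t.2) = 0 := by
    have h : f ^ j * ∑ t : Fin J × s,
        algebraMap K F (g t) * (if (t.1 : ℕ) < j then 0 else f ^ ((t.1 : ℕ) - j) * e t.2) = 0 := by
      rw [← hg, Finset.mul_sum]
      refine Finset.sum_congr rfl fun t _ => ?_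
      rw [Algebra.smul_def]
      split_ifs with ht
      · rw [ih t.1 ht t.1.2 t.2]
        simp
      · have h1 : f ^ (t.1 : ℕ) = f ^ j * f ^ ((t.1 : ℕ) - j) := by
          rw [← pow_add, Nat.add_sub_cancel' (not_lt.1 ht)]
        rw [h1]
        ring
    exact (mul_eq_zero.1 h).resolve_left (pow_ne_zero _ hf0)
  have hmem (t : Fin J × s) :
      (if (t.1 : ℕ) < j then 0 else f ^ ((t.1 : ℕ) - j) * e t.2) ∈ Q.1.ring := by
    split_ifs
    · exact zero_mem _
    · exact mul_mem (pow_mem hfQ' _) (he _ _)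
  have heval := congrArg Q.1.eval hsum
  rw [eval_sum _ _ _ fun t _ => mul_mem (Q.1.algebraMap_mem _) (hmem t), eval_zero,
    Finset.sum_eq_single (⟨j, hj⟩, Q), eval_mul _ (Q.1.algebraMap_mem _) (hmem _),
    eval_algebraMap] at heval
  · simpa [he1] using heval
  · rintro ⟨i, R⟩ - hne
    rw [eval_mul _ (Q.1.algebraMap_mem _) (hmem _)]
    refine mul_eq_zero_of_right _ ?_
    dsimp only
    split_ifs with hi
    · exact Q.1.eval_zero
    · rw [eval_mul _ (pow_mem hfQ' _) (he _ _), eval_pow _ hfQ',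
        (Q.1.eval_eq_zero_iff hfQ').2 hfQ]
      rcases (not_lt.1 hi).eq_or_lt with h | h
      · rw [he0 R Q, mul_zero]
        rintro rfl
        exact hne (Prod.ext (Fin.ext h.symm) rfl)
      · rw [zero_pow (Nat.sub_ne_zero_of_lt h), zero_mul]
  · simp

end RationalPlace

end SeparatedCurve

/-! ### The weight filtration and the bound on the number of zeros. -/

namespace SeparatedCurve

section Weight

variable {K F : Type*} [Field K] [Field F] [Algebra K F]

/-- The span of the monomials `y ^ j * x ^ i` of weight `j * b + i * a` at most `N`. -/
def weightSpace (K : Type*) {F : Type*} [Field K] [Field F] [Algebra K F] (x y : F)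
    (a b N : ℕ) : Submodule K F :=
  Submodule.span K {f | ∃ i j : ℕ, j * b + i * a ≤ N ∧ f = y ^ j * x ^ i}

theorem monomial_mem_weightSpace {x y : F} {a b N i j : ℕ} (h : j * b + i * a ≤ N) :
    y ^ j * x ^ i ∈ weightSpace K x y a b N :=
  Submodule.subset_span ⟨i, j, h, rfl⟩

theorem weightSpace_mono (x y : F) (a b : ℕ) : Monotone (weightSpace K x y a b) := by
  intro N M h
  refine Submodule.span_mono ?_
  rintro f ⟨i, j, hij, rfl⟩
  exact ⟨i, j, hij.trans h, rfl⟩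

theorem mul_mem_weightSpace {x y : F} {a b N M : ℕ} {f g : F}
    (hf : f ∈ weightSpace K x y a b N) (hg : g ∈ weightSpace K x y a b M) :
    f * g ∈ weightSpace K x y a b (N + M) := by
  have h := Submodule.mul_mem_mul hf hg
  rw [weightSpace, weightSpace, Submodule.span_mul_span] at h
  refine Submodule.span_mono ?_ h
  rintro _ ⟨_, ⟨i, j, hij, rfl⟩, _, ⟨k, l, hkl, rfl⟩, rfl⟩
  refine ⟨i + k, j + l, ?_, ?_⟩
  · rw [add_mul, add_mul]
    omega
  · ring

theorem pow_mem_weightSpace {x y : F} {a b N : ℕ} {f : F}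
    (hf : f ∈ weightSpace K x y a b N) (k : ℕ) : f ^ k ∈ weightSpace K x y a b (N * k) := by
  induction k with
  | zero =>
    rw [pow_zero]
    have h := monomial_mem_weightSpace (K := K) (x := x) (y := y) (a := a) (b := b) (N := N * 0)
      (i := 0) (j := 0) (by simp)
    simpa using h
  | succ k ih =>
    rw [pow_succ, mul_add, mul_one]
    exact mul_mem_weightSpace ih hf

/-- Modulo the equation of the curve the powers `x ^ i` with `i ≥ b` are superfluous. -/
theorem weightSpace_le_span {x y : F} {A B : K[X]} (hAB : aeval y A = aeval x B)
    (hB : 0 < B.natDegree) (N : ℕ) :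
    weightSpace K x y A.natDegree B.natDegree N ≤ Submodule.span K {f | ∃ i j : ℕ,
      i < B.natDegree ∧ j * B.natDegree + i * A.natDegree ≤ N ∧ f = y ^ j * x ^ i} := by
  set a := A.natDegree
  set b := B.natDegree with hb
  refine Submodule.span_le.2 ?_
  rintro _ ⟨i, j, hij, rfl⟩
  rw [SetLike.mem_coe]
  induction i using Nat.strong_induction_on generalizing j with
  | _ i ih =>
  by_cases hi : i < b
  · exact Submodule.subset_span ⟨i, j, hi, hij, rfl⟩
  obtain ⟨k, rfl⟩ := Nat.exists_eq_add_of_le (not_lt.1 hi)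
  have hlead : B.leadingCoeff ≠ 0 := by
    rw [Ne, leadingCoeff_eq_zero]
    rintro rfl
    simp [hb] at hB
  have hx : B.leadingCoeff • x ^ b = ∑ l ∈ Finset.range (a + 1), A.coeff l • y ^ l -
      ∑ l ∈ Finset.range b, B.coeff l • x ^ l := by
    rw [eq_sub_iff_add_eq, ← aeval_eq_sum_range, hAB, aeval_eq_sum_range, ← hb,
      Finset.sum_range_succ, add_comm]
    rfl
  -- Every monomial on the right has a smaller exponent of `x` and no larger weight, because `y ^ a`
  -- and `x ^ b` both have weight `a * b`.
  have key : y ^ j * x ^ (b + k) = B.leadingCoeff⁻¹ •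
      (∑ l ∈ Finset.range (a + 1), A.coeff l • (y ^ (j + l) * x ^ k) -
        ∑ l ∈ Finset.range b, B.coeff l • (y ^ j * x ^ (l + k))) := by
    rw [eq_inv_smul_iff₀ hlead]
    have h := congrArg (fun t => y ^ j * x ^ k * t) hx
    simp only [mul_sub, Finset.mul_sum, mul_smul_comm] at h
    convert h using 2
    · ring
    · refine Finset.sum_congr rfl fun l _ => ?_
      ring_nf
    · refine Finset.sum_congr rfl fun l _ => ?_
      ring_nf
  rw [key]
  rw [add_mul] at hij
  refine Submodule.smul_mem _ _ (Submodule.sub_mem _ ?_ ?_)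
  · refine Submodule.sum_mem _ fun l hl => Submodule.smul_mem _ _ (ih k (by omega) _ ?_)
    have h := Nat.mul_le_mul_right b (Nat.lt_succ_iff.1 (Finset.mem_range.1 hl))
    rw [add_mul]
    rw [mul_comm b a] at hij
    omega
  · refine Submodule.sum_mem _ fun l hl => Submodule.smul_mem _ _ ?_
    rw [Finset.mem_range] at hl
    refine ih (l + k) (by omega) _ ?_
    have h := Nat.mul_le_mul_right a hl.le
    rw [add_mul]
    omega

/-- For `i < b` the weight `j * b + i * a` determines `i` modulo `b` by coprimality, then `j`. So
each weight from `0` to `N` is taken by at most one of the spanning monomials. -/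
theorem weightSpace_finrank_le {x y : F} {A B : K[X]} (hAB : aeval y A = aeval x B)
    (hB : 0 < B.natDegree) (hc : Nat.Coprime A.natDegree B.natDegree) (N : ℕ) :
    FiniteDimensional K (weightSpace K x y A.natDegree B.natDegree N) ∧
      Module.finrank K (weightSpace K x y A.natDegree B.natDegree N) ≤ N + 1 := by
  classical
  set a := A.natDegree
  set b := B.natDegree
  let S := (Finset.range b ×ˢ Finset.range (N + 1)).filter fun p => p.2 * b + p.1 * a ≤ N
  let T := S.image fun p => y ^ p.2 * x ^ p.1
  have hS : S.card ≤ N + 1 := by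
    rw [← Finset.card_range (N + 1)]
    refine Finset.card_le_card_of_injOn (fun p => p.2 * b + p.1 * a) (fun p hp => ?_) ?_
    · have := (Finset.mem_filter.1 hp).2
      simpa [Nat.lt_succ_iff] using this
    · rintro ⟨i, j⟩ hp ⟨k, l⟩ hq h
      have hi : i < b := by
        have := (Finset.mem_filter.1 hp).1
        exact Finset.mem_range.1 (Finset.mem_product.1 this).1
      have hk : k < b := by
        have := (Finset.mem_filter.1 hq).1
        exact Finset.mem_range.1 (Finset.mem_product.1 this).1
      have h' : j * b + i * a = l * b + k * a := h
      have hmod : i * a ≡ k * a [MOD b] := by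
        have h1 : (j * b + i * a) % b = (l * b + k * a) % b := by rw [h']
        rwa [Nat.add_comm, Nat.add_mul_mod_self_right, Nat.add_comm,
          Nat.add_mul_mod_self_right] at h1
      have hik : i = k :=
        (Nat.ModEq.cancel_right_of_coprime hc.symm hmod).eq_of_lt_of_lt hi hk
      subst hik
      have hjl : j = l := Nat.eq_of_mul_eq_mul_right hB (Nat.add_right_cancel h')
      rw [hjl]
  have hle : weightSpace K x y a b N ≤ Submodule.span K (T : Set F) := by
    refine (weightSpace_le_span hAB hB N).trans (Submodule.span_mono ?_)
    rintro _ ⟨i, j, hi, hij, rfl⟩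
    refine Finset.mem_coe.2 (Finset.mem_image.2 ⟨(i, j), Finset.mem_filter.2 ⟨?_, hij⟩, rfl⟩)
    refine Finset.mem_product.2 ⟨Finset.mem_range.2 hi, Finset.mem_range.2 ?_⟩
    have h1 : j ≤ j * b := Nat.le_mul_of_pos_right j hB
    have h2 : j * b + i * a ≤ N := hij
    dsimp only
    omega
  have hfin : FiniteDimensional K (Submodule.span K (T : Set F)) :=
    FiniteDimensional.span_finset K T
  refine ⟨Submodule.finiteDimensional_of_le hle, ?_⟩
  calc _ ≤ Module.finrank K (Submodule.span K (T : Set F)) := Submodule.finrank_mono hle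
    _ ≤ T.card := finrank_span_finset_le_card T
    _ ≤ S.card := Finset.card_image_le
    _ ≤ N + 1 := hS

/-- A nonzero function of weight at most `m` has at most `m` rational zeros. -/
theorem card_zeros_le_of_mem_weightSpace [Finite K] {x y : F} {A B : K[X]}
    (hAB : aeval y A = aeval x B) (hB : 0 < B.natDegree)
    (hc : Nat.Coprime A.natDegree B.natDegree)
    (hfrac : ∀ e : F, ∃ h : F, h ≠ 0 ∧ (∃ N, h ∈ weightSpace K x y A.natDegree B.natDegree N) ∧
      ∃ N, h * e ∈ weightSpace K x y A.natDegree B.natDegree N)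
    {m : ℕ} {f : F} (hf : f ∈ weightSpace K x y A.natDegree B.natDegree m) (hf0 : f ≠ 0)
    (s : Finset (RationalPlace K F)) (hs : ∀ P ∈ s, f ∈ P.ring.nonunits) : s.card ≤ m := by
  classical
  choose e he he1 he0 using fun P : RationalPlace K F => P.exists_eval_eq_ite s
  choose h hh0 hh hhe using hfrac
  choose N hN using hh
  choose M hM using hhe
  let H := ∏ P ∈ s, h (e P)
  have hH0 : H ≠ 0 := Finset.prod_ne_zero_iff.2 fun P _ => hh0 _
  have hprod (t : Finset (RationalPlace K F)) : (∏ P ∈ t, h (e P)) ∈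
      weightSpace K x y A.natDegree B.natDegree (∑ P ∈ t, N (e P)) := by
    induction t using Finset.induction_on with
    | empty =>
      have h := monomial_mem_weightSpace (K := K) (x := x) (y := y) (a := A.natDegree)
        (b := B.natDegree) (N := 0) (i := 0) (j := 0) (by simp)
      simpa using h
    | insert P t hP ih =>
      rw [Finset.prod_insert hP, Finset.sum_insert hP]
      exact mul_mem_weightSpace (hN _) ih
  let D := ∑ P ∈ s, (N (e P) + M (e P))
  have hHe (P : RationalPlace K F) (hP : P ∈ s) :
      H * e P ∈ weightSpace K x y A.natDegree B.natDegree D := by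
    have h1 := mul_mem_weightSpace (hprod (s.erase P)) (hM (e P))
    have h2 : (∏ Q ∈ s.erase P, h (e Q)) * (h (e P) * e P) = H * e P := by
      rw [← mul_assoc, Finset.prod_erase_mul _ _ hP]
    rw [h2] at h1
    refine weightSpace_mono _ _ _ _ ?_ h1
    have h3 : D = ∑ Q ∈ s.erase P, (N (e Q) + M (e Q)) + (N (e P) + M (e P)) :=
      (Finset.sum_erase_add _ _ hP).symm
    rw [h3, Finset.sum_add_distrib]
    omega
  by_contra! hlt
  -- With this choice `J * (m + 1)` exceeds the dimension bound `m * (J - 1) + D + 1` by `m + 1`.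
  let J := D + 2
  have hli := RationalPlace.linearIndependent_pow_mul hf0 hs (fun P : s => e P)
    (fun P Q => he P Q) (fun P => he1 P)
    (fun P Q hQP => he0 P Q Q.2 fun h => hQP (Subtype.ext h)) J
  have hli2 : LinearIndependent K
      (fun t : Fin J × s => H * (f ^ (t.1 : ℕ) * e t.2)) :=
    hli.map' (LinearMap.mulLeft K H) (LinearMap.ker_eq_bot.2 (mul_right_injective₀ hH0))
  have hmem (t : Fin J × s) : H * (f ^ (t.1 : ℕ) * e t.2) ∈
      weightSpace K x y A.natDegree B.natDegree (m * (D + 1) + D) := by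
    rw [mul_left_comm]
    refine weightSpace_mono _ _ _ _ ?_
      (mul_mem_weightSpace (pow_mem_weightSpace hf t.1) (hHe t.2 t.2.2))
    have h1 : (t.1 : ℕ) ≤ D + 1 := Nat.lt_succ_iff.1 t.1.2
    have h2 := Nat.mul_le_mul_left m h1
    omega
  obtain ⟨hfin, hrank⟩ := weightSpace_finrank_le hAB hB hc (m * (D + 1) + D)
  have hli3 : LinearIndependent K (fun t : Fin J × s =>
      (⟨_, hmem t⟩ : weightSpace K x y A.natDegree B.natDegree (m * (D + 1) + D))) :=
    LinearIndependent.of_comp (Submodule.subtype _) hli2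
  have hcard := hli3.fintype_card_le_finrank.trans hrank
  rw [Fintype.card_prod, Fintype.card_fin, Fintype.card_coe] at hcard
  have h1 : J * (m + 1) ≤ J * s.card := Nat.mul_le_mul_left J hlt
  have h2 : J * (m + 1) = m * (D + 1) + D + 1 + (m + 1) := by
    simp only [J]
    ring
  omega

end Weight

end SeparatedCurve

/-! ### Regularity of `V` at the evaluation points, and the sizes of fibres. -/

namespace SeparatedCurve

section Places

variable {K F : Type*} [Field K] [Field F] [Algebra K F]

/-- `x` is regular wherever `y` is, being integral over `K[y]`. -/
theorem RationalPlace.mem_ring_of_aeval_eq (P : RationalPlace K F) {x y : F} {A B : K[X]}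
    (hAB : aeval y A = aeval x B) (hB : 0 < B.natDegree) (hy : y ∈ P.ring) : x ∈ P.ring := by
  by_contra hx
  have hx0 : x ≠ 0 := by
    rintro rfl
    exact hx (zero_mem _)
  have hz : x⁻¹ ∈ P.ring.nonunits := P.ring.inv_mem_nonunits_iff.2 (Or.inr hx)
  have hz' := ValuationSubring.nonunits_subset hz
  have hlead : B.leadingCoeff ≠ 0 := by
    rw [Ne, leadingCoeff_eq_zero]
    rintro rfl
    simp at hB
  have hA : aeval y A ∈ P.ring := by
    rw [aeval_eq_sum_range]
    refine sum_mem fun l _ => ?_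
    rw [Algebra.smul_def]
    exact mul_mem (P.algebraMap_mem _) (pow_mem hy _)
  obtain ⟨d, hd⟩ := Nat.exists_eq_succ_of_ne_zero hB.ne'
  -- The equation divided by `x ^ b`, with one factor `x⁻¹` pulled out. If `x` had a pole, this
  -- would put a nonzero constant in the maximal ideal.
  have key : algebraMap K F B.leadingCoeff =
      (aeval y A * x⁻¹ ^ d - ∑ l ∈ Finset.range (d + 1), algebraMap K F (B.coeff l) *
        x⁻¹ ^ (d - l)) * x⁻¹ := by
    have h : aeval y A = ∑ l ∈ Finset.range (d + 1), algebraMap K F (B.coeff l) * x ^ l +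
        algebraMap K F B.leadingCoeff * x ^ (d + 1) := by
      rw [hAB, aeval_eq_sum_range, hd, Finset.sum_range_succ, leadingCoeff, hd]
      simp only [Algebra.smul_def]
    have h2 (l : ℕ) (hl : l ∈ Finset.range (d + 1)) : algebraMap K F (B.coeff l) * x⁻¹ ^ (d - l) =
        algebraMap K F (B.coeff l) * x ^ l * x⁻¹ ^ d := by
      have h3 : x⁻¹ ^ d = x⁻¹ ^ l * x⁻¹ ^ (d - l) := by
        rw [← pow_add, Nat.add_sub_cancel' (Nat.lt_succ_iff.1 (Finset.mem_range.1 hl))]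
      have h4 : x ^ l * x⁻¹ ^ l = 1 := by rw [← mul_pow, mul_inv_cancel₀ hx0, one_pow]
      rw [h3]
      linear_combination (-(algebraMap K F (B.coeff l)) * x⁻¹ ^ (d - l)) * h4
    rw [Finset.sum_congr rfl h2, ← Finset.sum_mul, h, add_mul, add_sub_cancel_left, mul_assoc,
      mul_assoc, ← pow_succ, ← mul_pow, mul_inv_cancel₀ hx0, one_pow, mul_one]
  have hnon : algebraMap K F B.leadingCoeff ∈ P.ring.nonunits := by
    rw [key]
    refine P.mul_mem_nonunits (sub_mem (mul_mem hA (pow_mem hz' _)) (sum_mem fun l _ => ?_)) hz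
    exact mul_mem (P.algebraMap_mem _) (pow_mem hz' _)
  rw [← P.eval_eq_zero_iff (P.algebraMap_mem _), P.eval_algebraMap] at hnon
  exact hlead hnon

theorem RationalPlace.weightSpace_subset_ring (P : RationalPlace K F) {x y : F} {a b N : ℕ}
    (hx : x ∈ P.ring) (hy : y ∈ P.ring) {f : F} (hf : f ∈ weightSpace K x y a b N) :
    f ∈ P.ring := by
  induction hf using Submodule.span_induction with
  | mem f hf =>
    obtain ⟨i, j, -, rfl⟩ := hf
    exact mul_mem (pow_mem hy _) (pow_mem hx _)
  | zero => exact zero_mem _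
  | add f g _ _ hf hg => exact add_mem hf hg
  | smul c f _ hf =>
    rw [Algebra.smul_def]
    exact mul_mem (P.algebraMap_mem _) hf

theorem funSpace_le_weightSpace (x y : F) (a b r : ℕ) (ε ℓ : ℕ → ℕ)
    (hε : ∀ i < r, ε i = 0 ∨ ε i = 1) :
    funSpace K y x r ε ℓ ≤ weightSpace K x y a b (poleBound b a r ε ℓ) := by
  refine Submodule.span_le.2 ?_
  rintro _ ⟨i, hi, j, hj, rfl⟩
  rcases hε i hi with h | h
  · simp [h]
  · rw [h, Nat.cast_one, one_mul]
    refine monomial_mem_weightSpace ?_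
    have h1 : ε i * (ℓ i * b + i * a) ≤ poleBound b a r ε ℓ :=
      Finset.le_sup (f := fun i => ε i * (ℓ i * b + i * a)) (Finset.mem_range.2 hi)
    rw [h, one_mul] at h1
    have h2 := Nat.mul_le_mul_right b hj
    omega

theorem mem_evalPoints {φ : F} {U : Set K} {P : RationalPlace K F} :
    P ∈ evalPoints φ U ↔ φ ∈ P.ring ∧ P.eval φ ∈ U := by
  simp [evalPoints, fibre]

/-- `Set.ncard` is `0` on infinite sets, so `b ≠ 0` is what makes each fibre finite. -/
theorem finite_evalPoints [Finite K] {φ : F} {U : Set K} {b : ℕ} (hb : b ≠ 0)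
    (hU : ∀ β ∈ U, (fibre φ β).ncard = b) : (evalPoints φ U).Finite :=
  U.toFinite.biUnion fun β hβ => Set.finite_of_ncard_ne_zero (by rwa [hU β hβ])

theorem ncard_evalPoints [Finite K] {φ : F} {b : ℕ} (hb : b ≠ 0) (T : Finset K)
    (hT : ∀ β ∈ T, (fibre φ β).ncard = b) : (evalPoints φ (T : Set K)).ncard = T.card * b := by
  classical
  induction T using Finset.induction_on with
  | empty => simp [evalPoints]
  | insert β T hβ ih =>
    have h1 := fun γ hγ => hT γ (Finset.mem_insert_of_mem hγ)
    have h2 := hT β (Finset.mem_insert_self β T)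
    have h3 : evalPoints φ ((insert β T : Finset K) : Set K) =
        evalPoints φ (T : Set K) ∪ fibre φ β := by
      ext P
      simp only [Set.mem_union, mem_evalPoints, fibre, Set.mem_ofPred_eq, Finset.coe_insert,
        Set.mem_insert_iff]
      tauto
    rw [h3, Set.ncard_union_eq _ (finite_evalPoints hb h1)
      (Set.finite_of_ncard_ne_zero (by rwa [h2])), ih h1, h2, Finset.card_insert_of_notMem hβ,
      add_mul, one_mul]
    rw [Set.disjoint_left]
    rintro P hP ⟨-, rfl⟩
    exact hβ (mem_evalPoints.1 hP).2

theorem prod_sub_mem_funSpace {x y : F} {r : ℕ} (hr : 0 < r) {ε ℓ : ℕ → ℕ} (hε0 : ε 0 = 1)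
    (T : Finset K) (hT : T.card ≤ ℓ 0) :
    ∏ β ∈ T, (y - algebraMap K F β) ∈ funSpace K y x r ε ℓ := by
  have h : ∏ β ∈ T, (y - algebraMap K F β) = aeval y (∏ β ∈ T, (X - C β)) := by
    simp [map_prod]
  rw [h, aeval_eq_sum_range, natDegree_finsetProd_X_sub_C_eq_card]
  refine Submodule.sum_mem _ fun j hj => Submodule.smul_mem _ _ (Submodule.subset_span ?_)
  exact ⟨0, hr, j, (Nat.lt_succ_iff.1 (Finset.mem_range.1 hj)).trans hT, by simp [hε0]⟩

theorem RationalPlace.eval_prod_sub_eq_zero_iff (P : RationalPlace K F) {y : F}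
    (hy : y ∈ P.ring) (T : Finset K) :
    P.eval (∏ β ∈ T, (y - algebraMap K F β)) = 0 ↔ P.eval y ∈ T := by
  rw [(P.eval_prod T _ fun β _ => sub_mem hy (P.algebraMap_mem β)).2, Finset.prod_eq_zero_iff]
  constructor
  · rintro ⟨β, hβ, h⟩
    rw [P.eval_sub hy (P.algebraMap_mem β), P.eval_algebraMap, sub_eq_zero] at h
    rwa [h]
  · intro h
    exact ⟨_, h, by rw [P.eval_sub hy (P.algebraMap_mem _), P.eval_algebraMap, sub_self]⟩

end Places

/-! ### The function field of the curve. -/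

section Curve

variable {K : Type*} [Field K] (A B : K[X])

theorem aeval_yFun_eq_aeval_xFun : aeval (yFun A B) A = aeval (xFun A B) B := by
  have h : AdjoinRoot.mk (equation A B) (equation A B) = 0 := AdjoinRoot.mk_self
  rw [equation, map_sub, sub_eq_zero] at h
  have hA : aeval (yFun A B) A = algebraMap (CoordinateRing A B) (FunctionField A B)
      (AdjoinRoot.mk (equation A B) (C A)) := by
    rw [AdjoinRoot.mk_C, yFun, aeval_algebraMap_apply]
    have h1 := hom_eval₂ A C (AdjoinRoot.of (equation A B)) X
    rw [eval₂_C_X] at h1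
    rw [h1]
    rfl
  have hB : aeval (xFun A B) B = algebraMap (CoordinateRing A B) (FunctionField A B)
      (AdjoinRoot.mk (equation A B) (B.map C)) := by
    rw [xFun, aeval_algebraMap_apply]
    have h1 := AdjoinRoot.aeval_eq (f := equation A B) (B.map C)
    rw [← h1, aeval_def, aeval_def, eval₂_map]
    rfl
  rw [hA, hB]
  exact congrArg _ h

theorem exists_algebraMap_mem_weightSpace [Fact (AbsolutelyIrreducible A B)] (a b : ℕ) (r : CoordinateRing A B) :
    ∃ N, algebraMap (CoordinateRing A B) (FunctionField A B) r ∈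
      weightSpace K (xFun A B) (yFun A B) a b N := by
  obtain ⟨p, rfl⟩ := AdjoinRoot.mk_surjective r
  induction p using Polynomial.induction_on' with
  | add p q hp hq =>
    obtain ⟨N, hN⟩ := hp
    obtain ⟨M, hM⟩ := hq
    refine ⟨N + M, ?_⟩
    rw [map_add, map_add]
    exact add_mem (weightSpace_mono _ _ _ _ (by omega) hN)
      (weightSpace_mono _ _ _ _ (by omega) hM)
  | monomial i p =>
    induction p using Polynomial.induction_on' with
    | add p q hp hq =>
      obtain ⟨N, hN⟩ := hp
      obtain ⟨M, hM⟩ := hq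
      refine ⟨N + M, ?_⟩
      rw [map_add, map_add, map_add]
      exact add_mem (weightSpace_mono _ _ _ _ (by omega) hN)
        (weightSpace_mono _ _ _ _ (by omega) hM)
    | monomial j c =>
      refine ⟨j * b + i * a, ?_⟩
      have h : algebraMap (CoordinateRing A B) (FunctionField A B)
          (AdjoinRoot.mk (equation A B) (monomial i (monomial j c))) =
          c • (yFun A B ^ j * xFun A B ^ i) := by
        rw [← C_mul_X_pow_eq_monomial, ← C_mul_X_pow_eq_monomial]
        simp only [map_mul, map_pow, AdjoinRoot.mk_X, AdjoinRoot.mk_C]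
        rw [Algebra.smul_def, ← mul_assoc]
        rfl
      rw [h]
      exact Submodule.smul_mem _ _ (monomial_mem_weightSpace le_rfl)

/-- Supplies the denominators for the zero count: the monomials in `x` and `y` span the coordinate
ring, whose fractions are the function field. -/
theorem exists_mul_mem_weightSpace [Fact (AbsolutelyIrreducible A B)] (a b : ℕ) (e : FunctionField A B) :
    ∃ h : FunctionField A B, h ≠ 0 ∧ (∃ N, h ∈ weightSpace K (xFun A B) (yFun A B) a b N) ∧
      ∃ N, h * e ∈ weightSpace K (xFun A B) (yFun A B) a b N := by
  obtain ⟨r, s, hs, rfl⟩ := IsFractionRing.div_surjective (A := CoordinateRing A B) e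
  have hs0 : algebraMap (CoordinateRing A B) (FunctionField A B) s ≠ 0 :=
    IsFractionRing.to_map_ne_zero_of_mem_nonZeroDivisors hs
  refine ⟨_, hs0, exists_algebraMap_mem_weightSpace A B a b s, ?_⟩
  rw [mul_div_cancel₀ _ hs0]
  exact exists_algebraMap_mem_weightSpace A B a b r

/-- The equation has positive degree in `X`, so `K[Y]` embeds in the coordinate ring. -/
theorem yFun_sub_algebraMap_ne_zero (hB : B.natDegree ≠ 0) (c : K) :
    yFun A B - algebraMap K (FunctionField A B) c ≠ 0 := by
  have h : yFun A B - algebraMap K (FunctionField A B) c =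
      algebraMap (CoordinateRing A B) (FunctionField A B)
        (AdjoinRoot.of (equation A B) (X - C c)) := by
    rw [map_sub, map_sub]
    rfl
  rw [h, Ne, FaithfulSMul.algebraMap_eq_zero_iff]
  have hdeg : (equation A B).degree ≠ 0 := by
    intro h0
    have h1 := natDegree_eq_of_degree_eq_some (n := 0) h0
    rw [equation, natDegree_sub, natDegree_sub_C,
      natDegree_map_eq_of_injective C_injective] at h1
    exact hB h1
  rw [map_eq_zero_iff _ (AdjoinRoot.of.injective_of_degree_ne_zero hdeg)]
  exact X_sub_C_ne_zero c

end Curve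

end SeparatedCurve

/-! ### Abundance and the minimum distance. -/

theorem mainTheorem7 {K : Type*} [Field K] [Finite K] (A B : K[X])
    [Fact (SeparatedCurve.AbsolutelyIrreducible A B)]
    (a b : ℕ) (ha : A.natDegree = a) (hb : B.natDegree = b) (hab : Nat.Coprime a b)
    (hb2 : 2 ≤ b)
    (U : Set K) (hU : U ⊆ SeparatedCurve.splitValues A B)
    (Pts : Set (SeparatedCurve.RationalPlace K (SeparatedCurve.FunctionField A B)))
    (hPts : Pts = SeparatedCurve.evalPoints (SeparatedCurve.yFun A B) U)
    (n : ℕ) (hn : n = Pts.ncard)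
    (ε ℓ : ℕ → ℕ) (hε : ∀ i < b - 1, ε i = 0 ∨ ε i = 1) (hε0 : ε 0 = 1)
    (V : Submodule K (SeparatedCurve.FunctionField A B))
    (hV : V = SeparatedCurve.funSpace K
      (SeparatedCurve.yFun A B) (SeparatedCurve.xFun A B) (b - 1) ε ℓ)
    (m : ℕ) (hm : m = SeparatedCurve.poleBound b a (b - 1) ε ℓ) :
    (n ≤ ℓ 0 * b → SeparatedCurve.IsAbundant Pts V) ∧
    (ℓ 0 * b < n → ∃ d : ℕ, SeparatedCurve.IsMinDist (SeparatedCurve.code Pts V) d ∧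
      (n : ℤ) - m ≤ d ∧ (d : ℤ) ≤ n - ℓ 0 * b) := by
  classical
  open SeparatedCurve in
  set y := yFun A B
  set x := xFun A B
  have hAB : aeval y A = aeval x B := aeval_yFun_eq_aeval_xFun A B
  have hb0 : b ≠ 0 := by omega
  have hBpos : 0 < B.natDegree := by omega
  obtain ⟨T, rfl⟩ : ∃ T : Finset K, U = T := ⟨U.toFinite.toFinset, by simp⟩
  have hfib : ∀ β ∈ T, (fibre y β).ncard = b := fun β hβ => (hU hβ).trans hb
  have hnT : n = T.card * b := by rw [hn, hPts, ncard_evalPoints hb0 T hfib]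
  have hPfin : Pts.Finite := by
    rw [hPts]
    exact finite_evalPoints hb0 hfib
  have := hPfin.to_subtype
  have hmemP (P : Pts) : y ∈ P.1.ring ∧ P.1.eval y ∈ T := by
    have h : P.1 ∈ evalPoints y (T : Set K) := hPts.subset P.2
    exact mem_evalPoints.1 h
  have hreg (P : Pts) {f : FunctionField A B} (hf : f ∈ V) : f ∈ P.1.ring := by
    rw [hV] at hf
    exact P.1.weightSpace_subset_ring (P.1.mem_ring_of_aeval_eq hAB hBpos (hmemP P).1)
      (hmemP P).1 (funSpace_le_weightSpace x y a b _ ε ℓ hε hf)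
  have hprod (S : Finset K) (hS : S.card ≤ ℓ 0) : ∏ β ∈ S, (y - algebraMap K _ β) ∈ V := by
    rw [hV]
    exact prod_sub_mem_funSpace (by omega) hε0 S hS
  have hev0 : ev Pts (0 : FunctionField A B) = 0 := funext fun P => P.1.eval_zero
  constructor
  · intro hle hinj
    have hT : T.card ≤ ℓ 0 := by
      rw [hnT] at hle
      exact Nat.le_of_mul_le_mul_right hle (by omega)
    -- The product of `y - β` over all of `T` is a nonzero element of `V` that vanishes at every
    -- evaluation point.
    refine (Finset.prod_ne_zero_iff.2 fun β (_ : β ∈ T) =>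
      yFun_sub_algebraMap_ne_zero A B hBpos.ne' β) (hinj (hprod T hT) (zero_mem V) ?_)
    rw [hev0]
    exact funext fun P => (P.1.eval_prod_sub_eq_zero_iff (hmemP P).1 T).2 (hmemP P).2
  · intro hlt
    have hcompl (Z : Set Pts) : Z.ncard + Zᶜ.ncard = n := by
      rw [Set.ncard_add_ncard_compl, hn]
      rfl
    set W := {w | ∃ c ∈ code Pts (V : Submodule K (FunctionField A B)), ∃ c' ∈ code Pts V,
      c ≠ c' ∧ w = {i | c i ≠ c' i}.ncard} with hW
    have hmemW : n - ℓ 0 * b ∈ W := by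
      have hT : ℓ 0 < T.card := by
        rw [hnT] at hlt
        exact lt_of_mul_lt_mul_right hlt (Nat.zero_le b)
      obtain ⟨S, hST, hS⟩ := Finset.exists_subset_card_eq hT.le
      have hzero (P : Pts) : ev Pts (∏ β ∈ S, (y - algebraMap K _ β)) P = 0 ↔
          P.1 ∈ evalPoints y (S : Set K) := by
        rw [mem_evalPoints]
        exact (P.1.eval_prod_sub_eq_zero_iff (hmemP P).1 S).trans
          ⟨fun h => ⟨(hmemP P).1, h⟩, fun h => h.2⟩
      have hcard : {P : Pts | ev Pts (∏ β ∈ S, (y - algebraMap K _ β)) P = 0}.ncard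
          = ℓ 0 * b := by
        rw [← Set.ncard_image_of_injective _ Subtype.val_injective, ← hS,
          ← ncard_evalPoints hb0 S fun β hβ => hfib β (hST hβ)]
        congr 1
        ext P
        constructor
        · rintro ⟨P, hP, rfl⟩
          exact (hzero P).1 hP
        · intro hP
          have hP' : P ∈ Pts := by
            rw [hPts, mem_evalPoints]
            rw [mem_evalPoints] at hP
            exact ⟨hP.1, hST hP.2⟩
          exact ⟨⟨P, hP'⟩, (hzero ⟨P, hP'⟩).2 hP, rfl⟩
      have hw : n - ℓ 0 * b =
          {P : Pts | ev Pts (∏ β ∈ S, (y - algebraMap K _ β)) P ≠ ev Pts 0 P}.ncard := by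
        have h := hcompl {P : Pts | ev Pts (∏ β ∈ S, (y - algebraMap K _ β)) P = 0}
        rw [hcard] at h
        rw [hev0, ← h, Nat.add_sub_cancel_left]
        rfl
      refine ⟨_, ⟨_, hprod S hS.le, rfl⟩, _, ⟨0, zero_mem V, rfl⟩, fun h => ?_, hw⟩
      -- Equal words would be at distance `0`, whereas `n - ℓ 0 * b` is positive.
      rw [h] at hw
      simp only [ne_eq, not_true_eq_false, Set.ofPred_false, Set.ncard_empty] at hw
      omega
    refine ⟨sInf W, ⟨Nat.sInf_mem ⟨_, hmemW⟩, fun w hw => Nat.sInf_le hw⟩, ?_, ?_⟩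
    · obtain ⟨_, ⟨f, hf, rfl⟩, _, ⟨g, hg, rfl⟩, hne, hd⟩ := Nat.sInf_mem ⟨_, hmemW⟩
      have hfg : f - g ∈ V := sub_mem hf hg
      have hfg0 : f - g ≠ 0 := fun h => hne (by rw [sub_eq_zero.1 h])
      -- The words of `f` and `g` agree exactly at the evaluation points where `f - g` vanishes, and
      -- there are at most `m` of these.
      let Z := {P : Pts | ev Pts f P = ev Pts g P}
      have hZ : (Z.toFinite.toFinset.image Subtype.val).card ≤ m := by
        refine card_zeros_le_of_mem_weightSpace hAB hBpos (by rwa [ha, hb])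
          (exists_mul_mem_weightSpace A B _ _) (f := f - g) ?_ hfg0 _ fun P hP => ?_
        · rw [hV] at hfg
          rw [ha, hb, hm]
          exact funSpace_le_weightSpace x y a b _ ε ℓ hε hfg
        · obtain ⟨Q, hQ, rfl⟩ := Finset.mem_image.1 hP
          have hQ' : Q.1.eval f = Q.1.eval g := Z.toFinite.mem_toFinset.1 hQ
          rw [← Q.1.eval_eq_zero_iff (hreg Q hfg), Q.1.eval_sub (hreg Q hf) (hreg Q hg), hQ',
            sub_self]
      rw [Finset.card_image_of_injective _ Subtype.val_injective,
        ← Set.ncard_eq_toFinset_card] at hZ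
      have h1 := hcompl Z
      have h2 : Zᶜ.ncard = sInf W := hd.symm
      omega
    · have h := Nat.sInf_le hmemW
      rw [← Nat.cast_mul]
      omega
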